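/- **Setting.** A bilevel problem on $\mathbb R^p\times\mathbb R^q$ is a pair of functions $f,g:\mathbb R^p\times\mathbb R^q\to\mathbb R$; put $y^*(x)=\arg\min_y g(x,y)$ and $\Phi(x)=f(x,y^*(x))$. For constants $L_x,L_{xy},L_y,\widetilde L_{xy},\rho_{xy},\rho_{yy}\ge 0$, $0<\mu_y\le\widetilde L_y$ and $B>0$, the class $\mathcal F_{csc}$ consists of the problems with $f,g$ twice continuously differentiable such that: $\nabla_xf$ is $L_x$-Lipschitz in $x$ and $L_{xy}$-Lipschitz in $y$; $\nabla_yf$ is $L_{xy}$-Lipschitz in $x$ and $L_y$-Lipschitz in $y$; $\nabla_yg$ is $\widetilde L_{xy}$-Lipschitz in $x$ and $\widetilde L_y$-Lipschitz in $y$; $\nabla_x\nabla_yg$ and $\nabla_y^2g$ are $\rho_{xy}$- and $\rho_{yy}$-Lipschitz in $(x,y)$; $\Phi$ is convex; every $g(x,\cdot)$ is $\mu_y$-strongly convex; and $\Phi$ has a minimizer $x^*$ with $\|x^*\|=B$. **Algorithm class.** A run of a hypergradient-based algorithm has integers $K\ge 0$, $Q\ge1$, $T\ge1$ and update times $0\le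 s_0<\dots<s_{Q-1}\le K$. Its search spaces are $\mathcal H_x^0=\mathcal H_y^0=\{0\}$ and, for $0\le k<K$, $$\mathcal H_y^{k+1}=\mathrm{Span}\{y_i,\ \nabla_yg(\tilde x_i,\tilde y_i)\;:\;\tilde x_i\in\mathcal H_x^i,\ y_i,\tilde y_i\in\mathcal H_y^i,\ 0\le i\le k\};$$ if $k\ge1$ is an update time, then $$\mathcal H_x^{k}=\mathrm{Span}\Big\{x_i,\ \nabla_xf(\tilde x_i,\tilde y_i),\ \nabla_x\nabla_yg(x_i',y_i')\prod_{j=1}^t\big(I-\alpha\nabla_y^2g(x_{i,j},y_{i,j})\big)\nabla_yf(\hat x_i,\hat y_i)\Big\},$$ over $0\le t\le T$, $\alpha\in\mathbb R$, $0\le i\le k-1$ and all points of $\mathcal H_x^i$, $\mathcal H_y^i$; if $k\ge1$ is not an update time, then $\mathcal H_x^k=\mathcal H_x^{k-1}$. The iterates satisfy $x^k\in\mathcal H_x^k$, $y^k\in\mathcal H_y^k$ for $0\le k\le K$, and the output is $x^K$. With $n_J=Q$ Jacobian-vector products, $n_H=QT$ Hessian-vector products and $n_G=K$ gradient evaluations,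 the cost of the run is $\tau(n_J+n_H)+n_G$, where $\tau>0$. For an algorithm $\mathcal A$ of the class, $\mathcal C_{norm}(\mathcal A,\epsilon)$ is the least cost of its runs on the given problem with $\|\nabla\Phi(x^K)\|\le\epsilon$ ($\infty$ if there are none). **Theorem.** Given such constants and $\epsilon>0$, let $\beta=(\widetilde L_y-\mu_y)/4$ and let $r^*$ be the unique nonnegative solution (which exists) of $$r^4+r\Big(\frac{2\beta^4}{\mu_y^4}+\frac{4\beta^3}{\mu_y^3}+\frac{4\beta^2}{\mu_y^2}\Big)=\frac{B^2(\widetilde L_{xy}^2L_y+L_x\mu_y^2)^2}{128\,\mu_y^4\epsilon^2}.$$ There is an instance in $\mathcal F_{csc}$, with some dimensions $p=q=d$, such that every run of every hypergradient-based algorithm whose output satisfies $\|\nabla\Phi(x^K)\|\le\epsilon$ has $$M=K+QT-Q+3\ \ge\ \lfloor r^*\rfloor-3 .$$ Moreover, for every algorithm $\mathcal A$ of the class and every $\tau>0$, on this same instance: 1. $\mathcal C_{norm}(\mathcal A,\epsilon)\ge c_0\,r^*$, where $c_0>0$ depends only on $\tau$; 2. if $\beta\le\kappa\mu_y$ with $\kappa>0$,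 then $\mathcal C_{norm}(\mathcal A,\epsilon)\ge c_1\,\dfrac{B^{1/2}(\widetilde L_{xy}^2L_y+L_x\mu_y^2)^{1/2}}{\mu_y\,\epsilon^{1/2}}$, where $c_1>0$ depends only on $\tau,\kappa$; 3. if $\beta\le\beta_0$ with $\beta_0>0$, and $L_y,\widetilde L_{xy}>0$, then $\mathcal C_{norm}(\mathcal A,\epsilon)\ge c_2\,\dfrac1{\sqrt\epsilon}\min\Big\{\dfrac1{\mu_y},\dfrac1{\sqrt{\epsilon^3}}\Big\}$, where $c_2>0$ depends only on $\tau,\beta_0,L_x,L_y,\widetilde L_{xy},B$. -/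

import Mathlib

noncomputable section

/-- A bilevel problem: minimise `Φ x = f x (y* x)` over `x`, where `y* x` minimises `g x`. -/
structure BilevelProblem (p q : ℕ) where
  /-- outer-level function -/
  f : EuclideanSpace ℝ (Fin p) → EuclideanSpace ℝ (Fin q) → ℝ
  /-- inner-level function -/
  g : EuclideanSpace ℝ (Fin p) → EuclideanSpace ℝ (Fin q) → ℝ

namespace BilevelProblem

variable {p q : ℕ} (P : BilevelProblem p q)

/-- `∇ₓ f (x, y)` -/
def gradXf (x : EuclideanSpace ℝ (Fin p)) (y : EuclideanSpace ℝ (Fin q)) :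
    EuclideanSpace ℝ (Fin p) :=
  gradient (fun x' => P.f x' y) x

/-- `∇_y f (x, y)` -/
def gradYf (x : EuclideanSpace ℝ (Fin p)) (y : EuclideanSpace ℝ (Fin q)) :
    EuclideanSpace ℝ (Fin q) :=
  gradient (fun y' => P.f x y') y

/-- `∇_y g (x, y)` -/
def gradYg (x : EuclideanSpace ℝ (Fin p)) (y : EuclideanSpace ℝ (Fin q)) :
    EuclideanSpace ℝ (Fin q) :=
  gradient (fun y' => P.g x y') y

/-- The Hessian `∇_y² g (x, y)`, as an operator on `ℝ^q`. -/
def hessYg (x : EuclideanSpace ℝ (Fin p)) (y : EuclideanSpace ℝ (Fin q)) :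
    EuclideanSpace ℝ (Fin q) →L[ℝ] EuclideanSpace ℝ (Fin q) :=
  fderiv ℝ (fun y' => P.gradYg x y') y

/-- The mixed derivative `∇ₓ∇_y g (x, y)`, i.e. the `p × q` matrix `(∂²g / ∂xᵢ ∂yⱼ)`, as an
operator `ℝ^q → ℝ^p`: the transpose of the derivative of `∇_y g (·, y)`. -/
def jacXYg (x : EuclideanSpace ℝ (Fin p)) (y : EuclideanSpace ℝ (Fin q)) :
    EuclideanSpace ℝ (Fin q) →L[ℝ] EuclideanSpace ℝ (Fin p) :=
  ContinuousLinearMap.adjoint (fderiv ℝ (fun x' => P.gradYg x' y) x)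

/-- `y* x`, a minimiser of `g x` (it exists and is unique when `g x` is strongly convex and
continuous). -/
def yStar (x : EuclideanSpace ℝ (Fin p)) : EuclideanSpace ℝ (Fin q) :=
  Classical.epsilon fun y => ∀ y', P.g x y ≤ P.g x y'

/-- The total objective `Φ x = f x (y* x)`. -/
def Phi (x : EuclideanSpace ℝ (Fin p)) : ℝ :=
  P.f x (P.yStar x)

end BilevelProblem

/-- Membership in the convex–strongly-convex class with smoothness constants
`Lx, Lxy, Ly` (for `f`), `Ltxy, Lty` (for `g`), Lipschitz constants `ρxy, ρyy` of the second
derivatives of `g`, strong convexity constant `μy`, and norm `B` of a minimiser of `Φ`. -/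
structure InCSC {p q : ℕ} (Lx Lxy Ly Ltxy Lty ρxy ρyy μy B : ℝ) (P : BilevelProblem p q) :
    Prop where
  contDiff_f : ContDiff ℝ 2
    (fun z : EuclideanSpace ℝ (Fin p) × EuclideanSpace ℝ (Fin q) => P.f z.1 z.2)
  contDiff_g : ContDiff ℝ 2
    (fun z : EuclideanSpace ℝ (Fin p) × EuclideanSpace ℝ (Fin q) => P.g z.1 z.2)
  gradXf_x : ∀ x₁ x₂ y, ‖P.gradXf x₁ y - P.gradXf x₂ y‖ ≤ Lx * ‖x₁ - x₂‖
  gradXf_y : ∀ x y₁ y₂, ‖P.gradXf x y₁ - P.gradXf x y₂‖ ≤ Lxy * ‖y₁ - y₂‖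
  gradYf_x : ∀ x₁ x₂ y, ‖P.gradYf x₁ y - P.gradYf x₂ y‖ ≤ Lxy * ‖x₁ - x₂‖
  gradYf_y : ∀ x y₁ y₂, ‖P.gradYf x y₁ - P.gradYf x y₂‖ ≤ Ly * ‖y₁ - y₂‖
  gradYg_x : ∀ x₁ x₂ y, ‖P.gradYg x₁ y - P.gradYg x₂ y‖ ≤ Ltxy * ‖x₁ - x₂‖
  gradYg_y : ∀ x y₁ y₂, ‖P.gradYg x y₁ - P.gradYg x y₂‖ ≤ Lty * ‖y₁ - y₂‖
  jacXYg_lip : ∀ x₁ x₂ y₁ y₂, ‖P.jacXYg x₁ y₁ - P.jacXYg x₂ y₂‖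
    ≤ ρxy * Real.sqrt (‖x₁ - x₂‖ ^ 2 + ‖y₁ - y₂‖ ^ 2)
  hessYg_lip : ∀ x₁ x₂ y₁ y₂, ‖P.hessYg x₁ y₁ - P.hessYg x₂ y₂‖
    ≤ ρyy * Real.sqrt (‖x₁ - x₂‖ ^ 2 + ‖y₁ - y₂‖ ^ 2)
  convex_Phi : ConvexOn ℝ Set.univ P.Phi
  strongConvex_g : ∀ x, StrongConvexOn Set.univ μy (P.g x)
  exists_minimizer : ∃ xs, (∀ x, P.Phi xs ≤ P.Phi x) ∧ ‖xs‖ = B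

/-- The parameters of a hypergradient-based method: `K` iterations, of which the `Q` iterations
`s 0 < … < s (Q-1) ≤ K` update `x`, each update using at most `T` Hessian–vector products. -/
structure UpdateSchedule where
  K : ℕ
  Q : ℕ
  T : ℕ
  Q_pos : 0 < Q
  T_pos : 0 < T
  s : Fin Q → ℕ
  s_strictMono : StrictMono s
  s_le : ∀ m, s m ≤ K

namespace BilevelProblem

variable {p q : ℕ} (P : BilevelProblem p q)

/-- What the points of the search spaces `X`, `Y` contribute to a later search space for `y`. -/
def yGenerators (X : Submodule ℝ (EuclideanSpace ℝ (Fin p)))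
    (Y : Submodule ℝ (EuclideanSpace ℝ (Fin q))) : Set (EuclideanSpace ℝ (Fin q)) :=
  {v | v ∈ Y ∨ ∃ x ∈ X, ∃ y ∈ Y, v = P.gradYg x y}

/-- What the points of the search spaces `X`, `Y` contribute to a later search space for `x`:
points of `X`, gradients `∇ₓ f`, and the vectors
`∇ₓ∇_y g (x₀, y₀) ∏_{j ≤ t} (I - α ∇_y² g (xsⱼ, ysⱼ)) ∇_y f (x̂, ŷ)` with `t ≤ T`. -/
def xGenerators (T : ℕ) (X : Submodule ℝ (EuclideanSpace ℝ (Fin p)))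
    (Y : Submodule ℝ (EuclideanSpace ℝ (Fin q))) : Set (EuclideanSpace ℝ (Fin p)) :=
  {v | v ∈ X ∨ (∃ x ∈ X, ∃ y ∈ Y, v = P.gradXf x y) ∨
    ∃ t ≤ T, ∃ α : ℝ, ∃ x₀ ∈ X, ∃ y₀ ∈ Y, ∃ xh ∈ X, ∃ yh ∈ Y,
      ∃ xs : Fin t → EuclideanSpace ℝ (Fin p), ∃ ys : Fin t → EuclideanSpace ℝ (Fin q),
        (∀ j, xs j ∈ X) ∧ (∀ j, ys j ∈ Y) ∧
        v = P.jacXYg x₀ y₀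
          ((List.ofFn fun j => 1 - α • P.hessYg (xs j) (ys j)).prod (P.gradYf xh yh))}

open Classical in
/-- The pair of search spaces `(H_x^k, H_y^k)`. -/
def searchSpaces (S : UpdateSchedule) :
    ℕ → Submodule ℝ (EuclideanSpace ℝ (Fin p)) × Submodule ℝ (EuclideanSpace ℝ (Fin q))
  | 0 => (⊥, ⊥)
  | k + 1 =>
    (if ∃ m, S.s m = k + 1 then
        Submodule.span ℝ (⋃ i : Fin (k + 1),
          P.xGenerators S.T (searchSpaces S i.1).1 (searchSpaces S i.1).2)
      else (searchSpaces S k).1,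
      Submodule.span ℝ (⋃ i : Fin (k + 1),
        P.yGenerators (searchSpaces S i.1).1 (searchSpaces S i.1).2))
  termination_by k => k
  decreasing_by all_goals omega

end BilevelProblem

/-- A run, on the problem `P`, of a method of the hypergradient-based class. -/
structure HypergradientRun {p q : ℕ} (P : BilevelProblem p q) where
  schedule : UpdateSchedule
  x : ℕ → EuclideanSpace ℝ (Fin p)
  y : ℕ → EuclideanSpace ℝ (Fin q)
  x_mem : ∀ k ≤ schedule.K, x k ∈ (P.searchSpaces schedule k).1
  y_mem : ∀ k ≤ schedule.K, y k ∈ (P.searchSpaces schedule k).2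

namespace HypergradientRun

variable {p q : ℕ} {P : BilevelProblem p q} (R : HypergradientRun P)

/-- The output `x^K`. -/
def output : EuclideanSpace ℝ (Fin p) := R.x R.schedule.K

/-- number of Jacobian–vector products: one per update of `x` -/
def nJ : ℕ := R.schedule.Q

/-- number of Hessian–vector products: `T` per update of `x` -/
def nH : ℕ := R.schedule.Q * R.schedule.T

/-- number of gradient evaluations: one per iteration -/
def nG : ℕ := R.schedule.K

/-- The cost `τ (n_J + n_H) + n_G` of a run. -/
def cost (τ : ℝ) : ℝ := τ * (R.nJ + R.nH) + R.nG

end HypergradientRun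

/-- An algorithm of the hypergradient-based class, described by the runs that it can carry out
on each problem. -/
def HypergradientAlgorithm : Type :=
  ∀ (p q : ℕ) (P : BilevelProblem p q), Set (HypergradientRun P)

/-- The complexity `C_norm(A, ε)` of the algorithm `A` on the problem `P`: the least cost of a
run whose output satisfies `‖∇Φ(x^K)‖ ≤ ε`, and `∞` if there is no such run. -/
def normComplexity (τ : ℝ) (A : HypergradientAlgorithm) {p q : ℕ} (P : BilevelProblem p q)
    (ε : ℝ) : ENNReal :=
  ⨅ R ∈ A p q P, ⨅ _ : ‖gradient P.Phi R.output‖ ≤ ε, ENNReal.ofReal (R.cost τ)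

/-- `r` is the nonnegative solution `r*` of the equation
`r⁴ + r (2β⁴/μ⁴ + 4β³/μ³ + 4β²/μ²) = B² (L̃xy² Ly + Lx μ²)² / (128 μ⁴ ε²)`. -/
def IsRStar (Lx Ly Ltxy μy β B ε r : ℝ) : Prop :=
  0 ≤ r ∧
    r ^ 4 + r * (2 * β ^ 4 / μy ^ 4 + 4 * β ^ 3 / μy ^ 3 + 4 * β ^ 2 / μy ^ 2) =
      B ^ 2 * (Ltxy ^ 2 * Ly + Lx * μy ^ 2) ^ 2 / (128 * μy ^ 4 * ε ^ 2)

end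

/-! Take the inner function `g x y = μ/2 ‖y‖² - L̃ ⟪Z x - b, y⟫` and the outer function
`f x y = Lx/2 ‖Z x - b‖² + Ly/2 ‖y‖²`. The inner Hessian is the scalar `μ`, so Hessian–vector
products carry no information, and `y* x = (L̃/μ) (Z x - b)` turns the total objective into the
least-squares function `Φ x = Λ/2 ‖Z x - b‖²` with `Λ = Lx + L̃² Ly / μ²`.

For `Z` half the backward difference on `ℝᵈ` and `b` a multiple of the first unit vector, the
solution of `Z x = b` is a constant vector, while each iteration uncovers at most one more
coordinate: a run with `K < d` outputs a vector whose last entry vanishes. Pairing the residual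
`Z x - b` of such a vector with `Z v`, where `v = (1, …, d)`, gives `‖∇Φ x‖ ≥ Λ B / (4 d²)`. Hence
`‖∇Φ x^K‖ ≤ ε` forces `K + 1 ≥ √(Λ B / ε) / 2`. Dropping the linear term of the equation for `r*`
shows that `r*` is at most this bound, and every run costs at least `min (2 τ) 1 * (K + 1)`.
-/

open scoped InnerProductSpace

section Quadratic

variable {E F : Type*} [NormedAddCommGroup E] [InnerProductSpace ℝ E]
  [NormedAddCommGroup F] [InnerProductSpace ℝ F]

theorem hasGradientAt_norm_sq_affine [CompleteSpace E] [CompleteSpace F] (Z : E →L[ℝ] F) (b : F)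
    (a c : ℝ) (x : E) :
    HasGradientAt (fun x => a / 2 * ‖Z x - b‖ ^ 2 + c)
      (a • ContinuousLinearMap.adjoint Z (Z x - b)) x := by
  rw [hasGradientAt_iff_hasFDerivAt]
  have h := (((Z.hasFDerivAt (x := x)).sub_const b).norm_sq.const_mul (a / 2)).add_const c
  refine h.congr_fderiv ?_
  ext v
  simp [ContinuousLinearMap.adjoint_inner_left]
  ring

theorem hasGradientAt_norm_sq_sub_inner [CompleteSpace E] (μ : ℝ) (w y : E) :
    HasGradientAt (fun y => μ / 2 * ‖y‖ ^ 2 - ⟪w, y⟫_ℝ) (μ • y - w) y := by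
  rw [hasGradientAt_iff_hasFDerivAt]
  have h := ((hasFDerivAt_id (𝕜 := ℝ) y).norm_sq.const_mul (μ / 2)).sub
    ((innerSL ℝ w).hasFDerivAt (x := y))
  refine h.congr_fderiv ?_
  ext v
  simp
  ring

theorem norm_sq_sub_inner_eq_completed_square {μ : ℝ} (hμ : μ ≠ 0) (w y : E) :
    μ / 2 * ‖y‖ ^ 2 - ⟪w, y⟫_ℝ = μ / 2 * ‖y - μ⁻¹ • w‖ ^ 2 - ‖w‖ ^ 2 / (2 * μ) := by
  rw [norm_sub_sq_real, norm_smul, real_inner_smul_right, real_inner_comm w y, mul_pow,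
    Real.norm_eq_abs, sq_abs]
  field_simp
  ring

theorem norm_sq_sub_inner_lt_of_ne {μ : ℝ} (hμ : 0 < μ) {w y : E} (hy : y ≠ μ⁻¹ • w) :
    μ / 2 * ‖μ⁻¹ • w‖ ^ 2 - ⟪w, μ⁻¹ • w⟫_ℝ < μ / 2 * ‖y‖ ^ 2 - ⟪w, y⟫_ℝ := by
  have hpos : 0 < ‖y - μ⁻¹ • w‖ := norm_pos_iff.2 (sub_ne_zero.2 hy)
  rw [norm_sq_sub_inner_eq_completed_square hμ.ne' w y,
    norm_sq_sub_inner_eq_completed_square hμ.ne' w (μ⁻¹ • w), sub_self, norm_zero]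
  gcongr

theorem strongConvexOn_norm_sq_sub_inner (μ : ℝ) (w : E) :
    StrongConvexOn Set.univ μ (fun y => μ / 2 * ‖y‖ ^ 2 - ⟪w, y⟫_ℝ) := by
  rw [strongConvexOn_iff_convex]
  have h : ConvexOn ℝ Set.univ (innerₗ E (-w)) := LinearMap.convexOn _ convex_univ
  exact h.congr fun y _ => by simp

theorem convexOn_norm_sq_affine (Z : E →L[ℝ] F) (b : F) {a : ℝ} (ha : 0 ≤ a) :
    ConvexOn ℝ Set.univ (fun x => a * ‖Z x - b‖ ^ 2) := by
  have h : ConvexOn ℝ Set.univ (fun u : F => ‖u‖ ^ 2) :=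
    convexOn_univ_norm.pow (fun _ _ => norm_nonneg _) 2
  have hZ := ((h.translate_left (-b)).comp_linearMap Z.toLinearMap).smul ha
  exact hZ.congr fun x _ => by simp [sub_eq_add_neg]

theorem norm_adjoint_apply_apply_le [CompleteSpace E] [CompleteSpace F] {Z : E →L[ℝ] F}
    (hZ : ‖Z‖ ≤ 1) (x : E) : ‖ContinuousLinearMap.adjoint Z (Z x)‖ ≤ ‖x‖ := by
  have hZ' : ‖ContinuousLinearMap.adjoint Z‖ ≤ 1 := by rwa [LinearIsometryEquiv.norm_map]
  calc ‖ContinuousLinearMap.adjoint Z (Z x)‖ ≤ 1 * ‖Z x‖ :=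
        ContinuousLinearMap.le_of_opNorm_le _ hZ' _
    _ ≤ 1 * (1 * ‖x‖) := by gcongr; exact Z.le_of_opNorm_le hZ x
    _ = ‖x‖ := by ring

end Quadratic

namespace BilevelProblem

variable {p q : ℕ} {P : BilevelProblem p q}

theorem yStar_eq_of_forall_lt {x : EuclideanSpace ℝ (Fin p)} {y₀ : EuclideanSpace ℝ (Fin q)}
    (h : ∀ y ≠ y₀, P.g x y₀ < P.g x y) : P.yStar x = y₀ := by
  have hmin : ∀ y, P.g x y₀ ≤ P.g x y := fun y => by
    rcases eq_or_ne y y₀ with rfl | hy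
    · exact le_rfl
    · exact (h y hy).le
  by_contra hne
  exact (h _ hne).not_ge
    (Classical.epsilon_spec (p := fun y => ∀ y', P.g x y ≤ P.g x y') ⟨y₀, hmin⟩ y₀)

variable {X X' : Submodule ℝ (EuclideanSpace ℝ (Fin p))}
  {Y Y' : Submodule ℝ (EuclideanSpace ℝ (Fin q))}

theorem yGenerators_mono (hX : X ≤ X') (hY : Y ≤ Y') :
    P.yGenerators X Y ⊆ P.yGenerators X' Y' := by
  rintro v (hv | ⟨x, hx, y, hy, rfl⟩)
  · exact .inl (hY hv)
  · exact .inr ⟨x, hX hx, y, hY hy, rfl⟩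

theorem xGenerators_mono (T : ℕ) (hX : X ≤ X') (hY : Y ≤ Y') :
    P.xGenerators T X Y ⊆ P.xGenerators T X' Y' := by
  rintro v (hv | ⟨x, hx, y, hy, rfl⟩ |
    ⟨t, ht, α, x₀, hx₀, y₀, hy₀, xh, hxh, yh, hyh, xs, ys, hxs, hys, rfl⟩)
  · exact .inl (hX hv)
  · exact .inr (.inl ⟨x, hX hx, y, hY hy, rfl⟩)
  · exact .inr (.inr ⟨t, ht, α, x₀, hX hx₀, y₀, hY hy₀, xh, hX hxh, yh, hY hyh, xs, ys,
      fun j => hX (hxs j), fun j => hY (hys j), rfl⟩)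

theorem searchSpaces_le_of_generators_subset
    {V : ℕ → Submodule ℝ (EuclideanSpace ℝ (Fin p))}
    {W : ℕ → Submodule ℝ (EuclideanSpace ℝ (Fin q))} {S : UpdateSchedule}
    (hV : ∀ k, P.xGenerators S.T (V k) (W k) ⊆ V (k + 1))
    (hW : ∀ k, P.yGenerators (V k) (W k) ⊆ W (k + 1)) (k : ℕ) :
    (P.searchSpaces S k).1 ≤ V k ∧ (P.searchSpaces S k).2 ≤ W k := by
  have hVmono : Monotone V := monotone_nat_of_le_succ fun k _ hv => hV k (.inl hv)
  have hWmono : Monotone W := monotone_nat_of_le_succ fun k _ hv => hW k (.inl hv)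
  induction k using Nat.strong_induction_on with
  | _ k ih =>
    cases k with
    | zero => simp [searchSpaces]
    | succ k =>
      rw [searchSpaces]
      constructor
      · split_ifs
        · refine Submodule.span_le.2 (Set.iUnion_subset fun i => ?_)
          exact (xGenerators_mono S.T (ih i i.2).1 (ih i i.2).2).trans
            ((hV i).trans (hVmono i.2))
        · exact (ih k k.lt_succ_self).1.trans (hVmono k.le_succ)
      · refine Submodule.span_le.2 (Set.iUnion_subset fun i => ?_)
        exact (yGenerators_mono (ih i i.2).1 (ih i i.2).2).trans ((hW i).trans (hWmono i.2))

end BilevelProblem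

/-- The problem with outer function `Lx/2 ‖Z x - b‖² + Ly/2 ‖y‖²` and inner function
`μ/2 ‖y‖² - L ⟪Z x - b, y⟫`. Its total objective is a least-squares function, and its inner Hessian
is a scalar, so that Hessian–vector products reveal nothing about it. -/
noncomputable def leastSquaresProblem {p q : ℕ}
    (Z : EuclideanSpace ℝ (Fin p) →L[ℝ] EuclideanSpace ℝ (Fin q)) (b : EuclideanSpace ℝ (Fin q))
    (Lx Ly L μ : ℝ) : BilevelProblem p q where
  f x y := Lx / 2 * ‖Z x - b‖ ^ 2 + Ly / 2 * ‖y‖ ^ 2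
  g x y := μ / 2 * ‖y‖ ^ 2 - ⟪L • (Z x - b), y⟫_ℝ

namespace leastSquaresProblem

variable {p q : ℕ} (Z : EuclideanSpace ℝ (Fin p) →L[ℝ] EuclideanSpace ℝ (Fin q))
  (b : EuclideanSpace ℝ (Fin q)) (Lx Ly L μ : ℝ) (x : EuclideanSpace ℝ (Fin p))
  (y : EuclideanSpace ℝ (Fin q))

theorem gradXf_eq : (leastSquaresProblem Z b Lx Ly L μ).gradXf x y =
    Lx • ContinuousLinearMap.adjoint Z (Z x - b) :=
  (hasGradientAt_norm_sq_affine Z b Lx _ x).gradient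

theorem gradYf_eq : (leastSquaresProblem Z b Lx Ly L μ).gradYf x y = Ly • y := by
  have h := hasGradientAt_norm_sq_affine (.id ℝ (EuclideanSpace ℝ (Fin q))) 0 Ly
    (Lx / 2 * ‖Z x - b‖ ^ 2) y
  simp only [ContinuousLinearMap.id_apply, sub_zero, ContinuousLinearMap.adjoint_id] at h
  simpa only [BilevelProblem.gradYf, leastSquaresProblem, add_comm] using h.gradient

theorem gradYg_eq : (leastSquaresProblem Z b Lx Ly L μ).gradYg x y = μ • y - L • (Z x - b) :=
  (hasGradientAt_norm_sq_sub_inner μ (L • (Z x - b)) y).gradient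

theorem hessYg_eq : (leastSquaresProblem Z b Lx Ly L μ).hessYg x y = μ • 1 := by
  simp only [BilevelProblem.hessYg, gradYg_eq]
  exact (((hasFDerivAt_id (𝕜 := ℝ) y).const_smul μ).sub_const _).fderiv

theorem jacXYg_eq : (leastSquaresProblem Z b Lx Ly L μ).jacXYg x y =
    -(L • ContinuousLinearMap.adjoint Z) := by
  have h : HasFDerivAt (fun x' => μ • y - L • (Z x' - b)) (-(L • Z)) x :=
    ((Z.hasFDerivAt.sub_const b).const_smul L).const_sub (μ • y)
  simp only [BilevelProblem.jacXYg, gradYg_eq]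
  rw [h.fderiv]
  simp

theorem contDiff_f {n : WithTop ℕ∞} :
    ContDiff ℝ n (fun z : EuclideanSpace ℝ (Fin p) × EuclideanSpace ℝ (Fin q) =>
      (leastSquaresProblem Z b Lx Ly L μ).f z.1 z.2) := by
  have hres : ContDiff ℝ n (fun z : EuclideanSpace ℝ (Fin p) × EuclideanSpace ℝ (Fin q) =>
    Z z.1 - b) := by fun_prop
  exact (contDiff_const.mul (hres.norm_sq ℝ)).add (contDiff_const.mul (contDiff_snd.norm_sq ℝ))

theorem contDiff_g {n : WithTop ℕ∞} :
    ContDiff ℝ n (fun z : EuclideanSpace ℝ (Fin p) × EuclideanSpace ℝ (Fin q) =>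
      (leastSquaresProblem Z b Lx Ly L μ).g z.1 z.2) := by
  have hres : ContDiff ℝ n (fun z : EuclideanSpace ℝ (Fin p) × EuclideanSpace ℝ (Fin q) =>
    L • (Z z.1 - b)) := by fun_prop
  exact (contDiff_const.mul (contDiff_snd.norm_sq ℝ)).sub (hres.inner ℝ contDiff_snd)

section Objective

variable {μ}

theorem yStar_eq (hμ : 0 < μ) :
    (leastSquaresProblem Z b Lx Ly L μ).yStar x = μ⁻¹ • L • (Z x - b) :=
  BilevelProblem.yStar_eq_of_forall_lt fun _ hy => norm_sq_sub_inner_lt_of_ne hμ hy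

theorem Phi_eq (hμ : 0 < μ) : (leastSquaresProblem Z b Lx Ly L μ).Phi =
    fun x => (Lx + L ^ 2 * Ly / μ ^ 2) / 2 * ‖Z x - b‖ ^ 2 := by
  funext x
  rw [BilevelProblem.Phi, yStar_eq Z b Lx Ly L x hμ]
  simp only [leastSquaresProblem, norm_smul, mul_pow, Real.norm_eq_abs, sq_abs]
  field_simp

theorem gradient_Phi_eq (hμ : 0 < μ) : gradient (leastSquaresProblem Z b Lx Ly L μ).Phi x =
    (Lx + L ^ 2 * Ly / μ ^ 2) • ContinuousLinearMap.adjoint Z (Z x - b) := by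
  simpa only [Phi_eq Z b Lx Ly L hμ, add_zero] using
    (hasGradientAt_norm_sq_affine Z b (Lx + L ^ 2 * Ly / μ ^ 2) 0 x).gradient

end Objective

variable {Z b Lx Ly L μ}

theorem inCSC {Lxy Lty ρxy ρyy B : ℝ} (hLx : 0 ≤ Lx) (hLxy : 0 ≤ Lxy) (hLy : 0 ≤ Ly)
    (hL : 0 ≤ L) (hρxy : 0 ≤ ρxy) (hρyy : 0 ≤ ρyy) (hμ : 0 < μ) (hμLty : μ ≤ Lty)
    (hZ : ‖Z‖ ≤ 1) {xs : EuclideanSpace ℝ (Fin p)} (hxs : Z xs = b) (hB : ‖xs‖ = B) :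
    InCSC Lx Lxy Ly L Lty ρxy ρyy μ B (leastSquaresProblem Z b Lx Ly L μ) where
  contDiff_f := contDiff_f Z b Lx Ly L μ
  contDiff_g := contDiff_g Z b Lx Ly L μ
  gradXf_x x₁ x₂ y := by
    rw [gradXf_eq, gradXf_eq, ← smul_sub, ← map_sub, sub_sub_sub_cancel_right, ← map_sub,
      norm_smul, Real.norm_of_nonneg hLx]
    gcongr
    exact norm_adjoint_apply_apply_le hZ _
  gradXf_y x y₁ y₂ := by
    rw [gradXf_eq, gradXf_eq, sub_self, norm_zero]
    positivity
  gradYf_x x₁ x₂ y := by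
    rw [gradYf_eq, gradYf_eq, sub_self, norm_zero]
    positivity
  gradYf_y x y₁ y₂ := by
    rw [gradYf_eq, gradYf_eq, ← smul_sub, norm_smul, Real.norm_of_nonneg hLy]
  gradYg_x x₁ x₂ y := by
    rw [gradYg_eq, gradYg_eq, sub_sub_sub_cancel_left, ← smul_sub, sub_sub_sub_cancel_right,
      ← map_sub, norm_smul, Real.norm_of_nonneg hL, norm_sub_rev x₁]
    gcongr
    simpa only [one_mul] using Z.le_of_opNorm_le hZ (x₂ - x₁)
  gradYg_y x y₁ y₂ := by
    rw [gradYg_eq, gradYg_eq, sub_sub_sub_cancel_right, ← smul_sub, norm_smul,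
      Real.norm_of_nonneg hμ.le]
    gcongr
  jacXYg_lip x₁ x₂ y₁ y₂ := by
    rw [jacXYg_eq, jacXYg_eq, sub_self, norm_zero]
    positivity
  hessYg_lip x₁ x₂ y₁ y₂ := by
    rw [hessYg_eq, hessYg_eq, sub_self, norm_zero]
    positivity
  convex_Phi := by
    rw [Phi_eq Z b Lx Ly L hμ]
    exact convexOn_norm_sq_affine Z b (by positivity)
  strongConvex_g x := strongConvexOn_norm_sq_sub_inner μ (L • (Z x - b))
  exists_minimizer := by
    refine ⟨xs, fun x => ?_, hB⟩
    simp only [Phi_eq Z b Lx Ly L hμ, hxs, sub_self, norm_zero, zero_pow two_ne_zero, mul_zero]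
    positivity

section SearchSpaces

variable {V : ℕ → Submodule ℝ (EuclideanSpace ℝ (Fin p))}
  {W : ℕ → Submodule ℝ (EuclideanSpace ℝ (Fin q))}

theorem searchSpaces_le (hV : Monotone V) (hW : Monotone W) (hb : b ∈ W 1)
    (hZ : ∀ k, Set.MapsTo Z (V k) (W (k + 1)))
    (hZadj : ∀ k, Set.MapsTo (ContinuousLinearMap.adjoint Z) (W k) (V k))
    (S : UpdateSchedule) (k : ℕ) :
    ((leastSquaresProblem Z b Lx Ly L μ).searchSpaces S k).1 ≤ V k ∧
      ((leastSquaresProblem Z b Lx Ly L μ).searchSpaces S k).2 ≤ W k := by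
  have hres : ∀ {k x}, x ∈ V k → Z x - b ∈ W (k + 1) := fun hx =>
    sub_mem (hZ _ hx) (hW (Nat.le_add_left 1 _) hb)
  refine BilevelProblem.searchSpaces_le_of_generators_subset (fun k => ?_) (fun k => ?_) k
  · rintro v (hv | ⟨x, hx, y, -, rfl⟩ |
      ⟨t, -, α, x₀, -, y₀, -, xh, -, yh, hyh, xs, ys, -, -, rfl⟩)
    · exact hV k.le_succ hv
    · rw [gradXf_eq]
      exact (V (k + 1)).smul_mem _ (hZadj _ (hres hx))
    · have hstep : Set.MapsTo
          (1 - α • μ • 1 : EuclideanSpace ℝ (Fin q) →L[ℝ] EuclideanSpace ℝ (Fin q))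
          (W k) (W k) := fun w hw =>
        sub_mem hw ((W k).smul_mem α ((W k).smul_mem μ hw))
      simp only [hessYg_eq, gradYf_eq, jacXYg_eq, List.ofFn_const, List.prod_replicate,
        FunLike.coe_pow_eq_iterate]
      exact hV k.le_succ (neg_mem ((V k).smul_mem _
        (hZadj k (hstep.iterate t ((W k).smul_mem _ hyh)))))
  · rintro v (hv | ⟨x, hx, y, hy, rfl⟩)
    · exact hW k.le_succ hv
    · rw [gradYg_eq]
      exact sub_mem ((W (k + 1)).smul_mem _ (hW k.le_succ hy))
        ((W (k + 1)).smul_mem _ (hres hx))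

end SearchSpaces

end leastSquaresProblem

section ShiftOperators

variable (n : ℕ)

/-- The shift `(x₀, …, xₙ) ↦ (0, x₀, …, xₙ₋₁)` of `ℝⁿ⁺¹`. -/
noncomputable def rightShift :
    EuclideanSpace ℝ (Fin (n + 1)) →L[ℝ] EuclideanSpace ℝ (Fin (n + 1)) :=
  (EuclideanSpace.equiv (Fin (n + 1)) ℝ).symm.toContinuousLinearMap ∘L
    ContinuousLinearMap.pi (Fin.cases 0 fun j => EuclideanSpace.proj j.castSucc)

/-- The shift `(x₀, …, xₙ) ↦ (x₁, …, xₙ, 0)` of `ℝⁿ⁺¹`, the adjoint of `rightShift n`. -/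
noncomputable def leftShift :
    EuclideanSpace ℝ (Fin (n + 1)) →L[ℝ] EuclideanSpace ℝ (Fin (n + 1)) :=
  (EuclideanSpace.equiv (Fin (n + 1)) ℝ).symm.toContinuousLinearMap ∘L
    ContinuousLinearMap.pi (Fin.lastCases 0 fun j => EuclideanSpace.proj j.succ)

/-- The backward difference `(x₀, …, xₙ) ↦ (x₀, x₁ - x₀, …, xₙ - xₙ₋₁)` of `ℝⁿ⁺¹`. -/
noncomputable def backwardDifference :
    EuclideanSpace ℝ (Fin (n + 1)) →L[ℝ] EuclideanSpace ℝ (Fin (n + 1)) :=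
  1 - rightShift n

/-- The vectors of `ℝᵈ` that vanish outside their first `k` coordinates. -/
def initialSubspace (d k : ℕ) : Submodule ℝ (EuclideanSpace ℝ (Fin d)) where
  carrier := {x | ∀ i : Fin d, k ≤ i → x i = 0}
  add_mem' hx hy i hi := by simp [hx i hi, hy i hi]
  zero_mem' _ _ := rfl
  smul_mem' c x hx i hi := by simp [hx i hi]

variable {n}

@[simp]
theorem rightShift_apply_zero (x : EuclideanSpace ℝ (Fin (n + 1))) : rightShift n x 0 = 0 := by
  simp [rightShift]

@[simp]
theorem rightShift_apply_succ (x : EuclideanSpace ℝ (Fin (n + 1))) (i : Fin n) :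
    rightShift n x i.succ = x i.castSucc := by
  simp [rightShift]

@[simp]
theorem leftShift_apply_last (x : EuclideanSpace ℝ (Fin (n + 1))) :
    leftShift n x (Fin.last n) = 0 := by
  simp [leftShift]

@[simp]
theorem leftShift_apply_castSucc (x : EuclideanSpace ℝ (Fin (n + 1))) (i : Fin n) :
    leftShift n x i.castSucc = x i.succ := by
  simp [leftShift]

theorem norm_rightShift_le : ‖rightShift n‖ ≤ 1 := by
  refine ContinuousLinearMap.opNorm_le_bound _ zero_le_one fun x => ?_
  rw [one_mul, ← sq_le_sq₀ (norm_nonneg _) (norm_nonneg _), EuclideanSpace.norm_sq_eq,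
    EuclideanSpace.norm_sq_eq, Fin.sum_univ_succ, Fin.sum_univ_castSucc (fun i => ‖x i‖ ^ 2)]
  simp only [rightShift_apply_zero, rightShift_apply_succ, norm_zero]
  nlinarith [sq_nonneg ‖x (Fin.last n)‖]

theorem adjoint_rightShift : ContinuousLinearMap.adjoint (rightShift n) = leftShift n := by
  refine ((ContinuousLinearMap.eq_adjoint_iff _ _).2 fun x y => ?_).symm
  simp [PiLp.inner_apply, Fin.sum_univ_castSucc (fun i => y i * leftShift n x i),
    Fin.sum_univ_succ (fun i => rightShift n y i * x i)]

theorem adjoint_backwardDifference :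
    ContinuousLinearMap.adjoint (backwardDifference n) = 1 - leftShift n := by
  rw [backwardDifference, map_sub, adjoint_rightShift, ContinuousLinearMap.one_def,
    ContinuousLinearMap.adjoint_id]

@[simp]
theorem backwardDifference_apply_zero (x : EuclideanSpace ℝ (Fin (n + 1))) :
    backwardDifference n x 0 = x 0 := by
  simp [backwardDifference]

@[simp]
theorem backwardDifference_apply_succ (x : EuclideanSpace ℝ (Fin (n + 1))) (i : Fin n) :
    backwardDifference n x i.succ = x i.succ - x i.castSucc := by
  simp [backwardDifference]

theorem norm_backwardDifference_le : ‖backwardDifference n‖ ≤ 2 :=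
  calc ‖backwardDifference n‖ ≤ ‖(1 : EuclideanSpace ℝ (Fin (n + 1)) →L[ℝ] _)‖ + ‖rightShift n‖ :=
        norm_sub_le _ _
    _ ≤ 1 + 1 := add_le_add ContinuousLinearMap.norm_id_le norm_rightShift_le
    _ = 2 := one_add_one_eq_two

theorem sum_backwardDifference (x : EuclideanSpace ℝ (Fin (n + 1))) :
    ∑ i, backwardDifference n x i = x (Fin.last n) := by
  have h := (Fin.sum_univ_succ fun i => x i).symm.trans (Fin.sum_univ_castSucc fun i => x i)
  rw [Fin.sum_univ_succ]
  simp only [backwardDifference_apply_zero, backwardDifference_apply_succ, Finset.sum_sub_distrib]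
  linarith

theorem backwardDifference_const (c : ℝ) :
    backwardDifference n (WithLp.toLp 2 fun _ => c) = EuclideanSpace.single 0 c := by
  ext i
  cases i using Fin.cases <;> simp

theorem backwardDifference_natCast_add_one :
    backwardDifference n (WithLp.toLp 2 fun i => (i : ℝ) + 1) = WithLp.toLp 2 fun _ => 1 := by
  ext i
  cases i using Fin.cases <;> simp

theorem initialSubspace_mono (d : ℕ) : Monotone (initialSubspace d) :=
  fun _ _ hkl _ hx i hi => hx i (hkl.trans hi)

theorem single_zero_mem_initialSubspace (t : ℝ) :
    EuclideanSpace.single (0 : Fin (n + 1)) t ∈ initialSubspace (n + 1) 1 := fun i hi => by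
  simp [Fin.pos_iff_ne_zero.1 (Nat.lt_of_succ_le hi)]

theorem mapsTo_backwardDifference (k : ℕ) : Set.MapsTo (backwardDifference n)
    (initialSubspace (n + 1) k) (initialSubspace (n + 1) (k + 1)) := by
  intro x hx i hi
  cases i using Fin.cases with
  | zero => simp at hi
  | succ i =>
    have hki : k ≤ i.castSucc := by simpa using hi
    have hki' : k ≤ i.succ := by simpa using hki.trans (Nat.le_succ _)
    simp [hx _ hki, hx _ hki']

theorem mapsTo_adjoint_backwardDifference (k : ℕ) :
    Set.MapsTo (ContinuousLinearMap.adjoint (backwardDifference n))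
      (initialSubspace (n + 1) k) (initialSubspace (n + 1) k) := by
  intro x hx i hi
  rw [adjoint_backwardDifference]
  cases i using Fin.lastCases with
  | last => simp [hx _ hi]
  | cast i =>
    have hki : k ≤ i.succ := by simpa using Nat.le_succ_of_le hi
    simp [hx _ hi, hx _ hki]

theorem norm_natCast_add_one_le :
    ‖(WithLp.toLp 2 fun i : Fin (n + 1) => (i : ℝ) + 1)‖ ≤ (n + 1) * √(n + 1) := by
  rw [EuclideanSpace.norm_eq, Real.sqrt_le_left (by positivity), mul_pow,
    Real.sq_sqrt (by positivity)]
  calc ∑ i : Fin (n + 1), ‖(i : ℝ) + 1‖ ^ 2 ≤ ∑ _i : Fin (n + 1), ((n : ℝ) + 1) ^ 2 := by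
        gcongr with i
        rw [Real.norm_of_nonneg (by positivity)]
        gcongr
        exact i.is_le
    _ = (n + 1) ^ 2 * (n + 1) := by simp [mul_comm]

/- Pairing the residual with the solution of `D v = 1` turns it into the sum of its entries, which
is `-t` because the sum of the entries of `D x` telescopes. -/
theorem abs_le_norm_adjoint_backwardDifference {x : EuclideanSpace ℝ (Fin (n + 1))}
    (hx : x (Fin.last n) = 0) (t : ℝ) :
    |t| ≤ (n + 1) * √(n + 1) * ‖ContinuousLinearMap.adjoint (backwardDifference n)
      (backwardDifference n x - EuclideanSpace.single 0 t)‖ := by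
  set u := backwardDifference n x - EuclideanSpace.single 0 t with hu
  set v : EuclideanSpace ℝ (Fin (n + 1)) := WithLp.toLp 2 fun i => (i : ℝ) + 1
  have hsum : ⟪v, ContinuousLinearMap.adjoint (backwardDifference n) u⟫_ℝ = -t := by
    rw [ContinuousLinearMap.adjoint_inner_right, backwardDifference_natCast_add_one]
    simp [PiLp.inner_apply, hu, Finset.sum_sub_distrib, sum_backwardDifference, hx]
  calc |t| = |⟪v, ContinuousLinearMap.adjoint (backwardDifference n) u⟫_ℝ| := by
        rw [hsum, abs_neg]
    _ ≤ ‖v‖ * ‖ContinuousLinearMap.adjoint (backwardDifference n) u‖ :=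
        abs_real_inner_le_norm _ _
    _ ≤ (n + 1) * √(n + 1) * ‖ContinuousLinearMap.adjoint (backwardDifference n) u‖ := by
        gcongr
        exact norm_natCast_add_one_le

end ShiftOperators

/-- The least-squares problem whose operator is half the backward difference on `ℝⁿ⁺¹` and whose
right-hand side is a multiple of the first unit vector, scaled so that the vector with all entries
`B / √(n + 1)`, whose norm is `B`, solves it. Each iteration reveals at most one new coordinate. -/
noncomputable def hardInstance (n : ℕ) (Lx Ly L μ B : ℝ) : BilevelProblem (n + 1) (n + 1) :=
  leastSquaresProblem ((2⁻¹ : ℝ) • backwardDifference n)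
    ((2⁻¹ : ℝ) • EuclideanSpace.single 0 (B / √(n + 1))) Lx Ly L μ

namespace hardInstance

variable {n : ℕ} {Lx Ly L μ B : ℝ}

theorem inCSC {Lxy Lty ρxy ρyy : ℝ} (hLx : 0 ≤ Lx) (hLxy : 0 ≤ Lxy) (hLy : 0 ≤ Ly)
    (hL : 0 ≤ L) (hρxy : 0 ≤ ρxy) (hρyy : 0 ≤ ρyy) (hμ : 0 < μ) (hμLty : μ ≤ Lty) (hB : 0 ≤ B) :
    InCSC Lx Lxy Ly L Lty ρxy ρyy μ B (hardInstance n Lx Ly L μ B) := by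
  have hZ : ‖(2⁻¹ : ℝ) • backwardDifference n‖ ≤ 1 := by
    rw [norm_smul, Real.norm_of_nonneg (by norm_num)]
    linarith [norm_backwardDifference_le (n := n)]
  refine leastSquaresProblem.inCSC (xs := WithLp.toLp 2 fun _ => B / √(n + 1)) hLx hLxy hLy hL
    hρxy hρyy hμ hμLty hZ ?_ ?_
  · rw [smul_apply, backwardDifference_const]
  · rw [EuclideanSpace.norm_eq]
    simp only [Real.norm_eq_abs, sq_abs, Finset.sum_const, Finset.card_univ, Fintype.card_fin,
      nsmul_eq_mul, Nat.cast_add_one]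
    rw [div_pow, Real.sq_sqrt (by positivity), mul_div_cancel₀ _ (by positivity), Real.sqrt_sq hB]

theorem searchSpaces_le (S : UpdateSchedule) (k : ℕ) :
    ((hardInstance n Lx Ly L μ B).searchSpaces S k).1 ≤ initialSubspace (n + 1) k := by
  refine (leastSquaresProblem.searchSpaces_le (initialSubspace_mono _) (initialSubspace_mono _)
    (Submodule.smul_mem _ _ (single_zero_mem_initialSubspace _)) (fun j x hx => ?_)
    (fun j x hx => ?_) S k).1
  · exact Submodule.smul_mem _ _ (mapsTo_backwardDifference j hx)
  · rw [map_smulₛₗ]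
    exact Submodule.smul_mem _ _ (mapsTo_adjoint_backwardDifference j hx)

theorem gradient_Phi_eq (hμ : 0 < μ) (x : EuclideanSpace ℝ (Fin (n + 1))) :
    gradient (hardInstance n Lx Ly L μ B).Phi x = ((Lx + L ^ 2 * Ly / μ ^ 2) / 4) •
      ContinuousLinearMap.adjoint (backwardDifference n)
        (backwardDifference n x - EuclideanSpace.single 0 (B / √(n + 1))) := by
  rw [hardInstance, leastSquaresProblem.gradient_Phi_eq _ _ _ _ _ _ hμ, smul_apply, ← smul_sub,
    map_smul, map_smulₛₗ, smul_apply, smul_smul, smul_smul]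
  congr 1
  simp only [conj_trivial]
  ring

theorem le_norm_gradient_Phi (hμ : 0 < μ)
    {R : HypergradientRun (hardInstance n Lx Ly L μ B)} (hK : R.schedule.K ≤ n) :
    |B * (Lx + L ^ 2 * Ly / μ ^ 2)| ≤
      4 * (n + 1) ^ 2 * ‖gradient (hardInstance n Lx Ly L μ B).Phi R.output‖ := by
  have hlast : R.output (Fin.last n) = 0 :=
    searchSpaces_le R.schedule _ (R.x_mem _ le_rfl) (Fin.last n) hK
  have hres := abs_le_norm_adjoint_backwardDifference hlast (B / √(n + 1))
  rw [abs_div, abs_of_nonneg (Real.sqrt_nonneg _), div_le_iff₀ (by positivity)] at hres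
  rw [gradient_Phi_eq hμ, norm_smul, Real.norm_eq_abs, abs_div, abs_mul]
  set G := ‖ContinuousLinearMap.adjoint (backwardDifference n)
    (backwardDifference n R.output - EuclideanSpace.single 0 (B / √(n + 1)))‖
  calc |B| * |Lx + L ^ 2 * Ly / μ ^ 2|
      ≤ ((n + 1) * √(n + 1) * G * √(n + 1)) * |Lx + L ^ 2 * Ly / μ ^ 2| := by gcongr
    _ = (n + 1) * √(n + 1) ^ 2 * G * |Lx + L ^ 2 * Ly / μ ^ 2| := by ring
    _ = 4 * (n + 1) ^ 2 * (|Lx + L ^ 2 * Ly / μ ^ 2| / |4| * G) := by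
      rw [Real.sq_sqrt (by positivity), abs_of_pos (four_pos (α := ℝ))]
      ring

theorem rate_le (hμ : 0 < μ) (hB : 0 ≤ B) {ε : ℝ} (hε : 0 < ε)
    {R : HypergradientRun (hardInstance n Lx Ly L μ B)} (hK : R.schedule.K ≤ n)
    (hR : ‖gradient (hardInstance n Lx Ly L μ B).Phi R.output‖ ≤ ε) :
    √B * √(L ^ 2 * Ly + Lx * μ ^ 2) / (μ * √ε) ≤ 2 * (n + 1) := by
  have hgrad : B * (Lx + L ^ 2 * Ly / μ ^ 2) ≤ 4 * (n + 1) ^ 2 * ε :=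
    (le_abs_self _).trans ((le_norm_gradient_Phi hμ hK).trans (by gcongr))
  have hscale : B * (L ^ 2 * Ly + Lx * μ ^ 2) = B * (Lx + L ^ 2 * Ly / μ ^ 2) * μ ^ 2 := by
    field_simp
    ring
  rw [div_le_iff₀ (by positivity), ← Real.sqrt_mul hB, Real.sqrt_le_left (by positivity), hscale,
    mul_pow, mul_pow, mul_pow, Real.sq_sqrt hε.le]
  nlinarith [mul_le_mul_of_nonneg_right hgrad (sq_nonneg μ)]

end hardInstance

theorem exists_inCSC_forall_rate_le {Lx Lxy Ly Ltxy Lty ρxy ρyy μy B ε : ℝ} (hLx : 0 ≤ Lx)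
    (hLxy : 0 ≤ Lxy) (hLy : 0 ≤ Ly) (hLtxy : 0 ≤ Ltxy) (hρxy : 0 ≤ ρxy) (hρyy : 0 ≤ ρyy)
    (hμy : 0 < μy) (hμLty : μy ≤ Lty) (hB : 0 ≤ B) (hε : 0 < ε) :
    ∃ (d : ℕ) (P : BilevelProblem d d), InCSC Lx Lxy Ly Ltxy Lty ρxy ρyy μy B P ∧
      ∀ R : HypergradientRun P, ‖gradient P.Phi R.output‖ ≤ ε →
        √B * √(Ltxy ^ 2 * Ly + Lx * μy ^ 2) / (μy * √ε) / 2 ≤ R.schedule.K + 1 := by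
  set m := √B * √(Ltxy ^ 2 * Ly + Lx * μy ^ 2) / (μy * √ε) / 2 with hm
  refine ⟨⌈m⌉₊ - 2 + 1, hardInstance (⌈m⌉₊ - 2) Lx Ly Ltxy μy B,
    hardInstance.inCSC hLx hLxy hLy hLtxy hρxy hρyy hμy hμLty hB, fun R hR => ?_⟩
  by_contra! hlt
  have hK : R.schedule.K + 1 < ⌈m⌉₊ := Nat.lt_ceil.2 (by exact_mod_cast hlt)
  have hle := hardInstance.rate_le hμy hB hε (by omega) hR
  have hlt' : ((⌈m⌉₊ - 2 + 1 : ℕ) : ℝ) < m := Nat.lt_ceil.1 (by omega)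
  rw [Nat.cast_add_one] at hlt'
  linarith

theorem existsUnique_pow_add_mul_eq {n : ℕ} (hn : n ≠ 0) {C A : ℝ} (hC : 0 ≤ C) (hA : 0 ≤ A) :
    ∃! r : ℝ, 0 ≤ r ∧ r ^ n + r * C = A := by
  have hmono : StrictMonoOn (fun r : ℝ => r ^ n + r * C) (Set.Ici 0) := by
    intro r hr s _ hrs
    have hpow : r ^ n < s ^ n := pow_lt_pow_left₀ hrs hr hn
    exact add_lt_add_of_lt_of_le hpow (by gcongr)
  have hA_mem : A ∈ Set.Icc ((0 : ℝ) ^ n + 0 * C) ((A + 1) ^ n + (A + 1) * C) := by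
    have hpow : A + 1 ≤ (A + 1) ^ n := le_self_pow₀ (by linarith) hn
    refine ⟨by simpa [hn] using hA, ?_⟩
    nlinarith [mul_nonneg (add_nonneg hA zero_le_one) hC]
  obtain ⟨r, hr, hrA⟩ := intermediate_value_Icc (f := fun r : ℝ => r ^ n + r * C)
    (by positivity) (by fun_prop) hA_mem
  exact ⟨r, ⟨hr.1, hrA⟩, fun s hs => hmono.injOn hs.1 hr.1 (hs.2.trans hrA.symm)⟩

namespace IsRStar

variable {Lx Ly Ltxy μy β B ε r : ℝ}

theorem existsUnique (hμy : 0 ≤ μy) (hβ : 0 ≤ β) :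
    ∃! r : ℝ, IsRStar Lx Ly Ltxy μy β B ε r :=
  existsUnique_pow_add_mul_eq four_ne_zero (by positivity) (by positivity)

theorem le_rate (hr : IsRStar Lx Ly Ltxy μy β B ε r) (hLx : 0 ≤ Lx) (hLy : 0 ≤ Ly)
    (hμy : 0 < μy) (hβ : 0 ≤ β) (hB : 0 ≤ B) (hε : 0 < ε) :
    r ≤ √B * √(Ltxy ^ 2 * Ly + Lx * μy ^ 2) / (μy * √ε) / 2 := by
  obtain ⟨hr₀, hr⟩ := hr
  have hD : 0 ≤ Ltxy ^ 2 * Ly + Lx * μy ^ 2 := by positivity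
  rw [← pow_le_pow_iff_left₀ hr₀ (by positivity) four_ne_zero]
  calc r ^ 4
      ≤ r ^ 4 + r * (2 * β ^ 4 / μy ^ 4 + 4 * β ^ 3 / μy ^ 3 + 4 * β ^ 2 / μy ^ 2) :=
        le_add_of_nonneg_right (by positivity)
    _ = B ^ 2 * (Ltxy ^ 2 * Ly + Lx * μy ^ 2) ^ 2 / (128 * μy ^ 4 * ε ^ 2) := hr
    _ ≤ B ^ 2 * (Ltxy ^ 2 * Ly + Lx * μy ^ 2) ^ 2 / (16 * μy ^ 4 * ε ^ 2) := by
        gcongr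
        norm_num
    _ = (√B ^ 2) ^ 2 * (√(Ltxy ^ 2 * Ly + Lx * μy ^ 2) ^ 2) ^ 2 /
          (16 * μy ^ 4 * (√ε ^ 2) ^ 2) := by
        rw [Real.sq_sqrt hB, Real.sq_sqrt hD, Real.sq_sqrt hε.le]
    _ = (√B * √(Ltxy ^ 2 * Ly + Lx * μy ^ 2) / (μy * √ε) / 2) ^ 4 := by ring

end IsRStar

theorem mul_le_rate {Lx Ly Ltxy μy B ε : ℝ} (hLx : 0 ≤ Lx) (hLtxy : 0 ≤ Ltxy) (hμy : 0 ≤ μy) :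
    √B * Ltxy * √Ly * (1 / √ε * (1 / μy)) ≤
      √B * √(Ltxy ^ 2 * Ly + Lx * μy ^ 2) / (μy * √ε) := by
  have hsqrt : Ltxy * √Ly ≤ √(Ltxy ^ 2 * Ly + Lx * μy ^ 2) := by
    rw [← Real.sqrt_sq hLtxy, ← Real.sqrt_mul (sq_nonneg _), Real.sq_sqrt (sq_nonneg _)]
    exact Real.sqrt_le_sqrt (le_add_of_nonneg_right (by positivity))
  calc √B * Ltxy * √Ly * (1 / √ε * (1 / μy)) = √B * (Ltxy * √Ly) / (μy * √ε) := by ring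
    _ ≤ √B * √(Ltxy ^ 2 * Ly + Lx * μy ^ 2) / (μy * √ε) := by gcongr

namespace HypergradientRun

variable {p q : ℕ} {P : BilevelProblem p q} {τ m ε : ℝ}

theorem min_mul_le_cost (R : HypergradientRun P) (hτ : 0 ≤ τ) :
    min (2 * τ) 1 * (R.schedule.K + 1) ≤ R.cost τ := by
  have hQ : (1 : ℝ) ≤ R.schedule.Q := by exact_mod_cast R.schedule.Q_pos
  have hQT : (1 : ℝ) ≤ R.schedule.Q * R.schedule.T := by
    exact_mod_cast Nat.mul_pos R.schedule.Q_pos R.schedule.T_pos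
  calc min (2 * τ) 1 * (R.schedule.K + 1)
      = min (2 * τ) 1 + min (2 * τ) 1 * R.schedule.K := by ring
    _ ≤ τ * (1 + 1) + 1 * R.schedule.K := by
        gcongr
        · linarith [min_le_left (2 * τ) 1]
        · exact min_le_right _ _
    _ ≤ τ * (R.schedule.Q + R.schedule.Q * R.schedule.T) + R.schedule.K := by
        rw [one_mul]
        gcongr
    _ = R.cost τ := by simp [cost, nJ, nH, nG]

theorem floor_le_of_le_K_add_one {R : HypergradientRun P} (h : m ≤ R.schedule.K + 1) :
    ⌊m⌋ - 3 ≤ (R.schedule.K : ℤ) + R.schedule.Q * R.schedule.T - R.schedule.Q + 3 := by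
  have hfloor : ⌊m⌋ ≤ R.schedule.K + 1 := by
    exact_mod_cast (Int.floor_le m).trans h
  have hQT : (R.schedule.Q : ℤ) ≤ R.schedule.Q * R.schedule.T := by
    exact_mod_cast Nat.le_mul_of_pos_right _ R.schedule.T_pos
  linarith

theorem ofReal_min_mul_le_normComplexity
    (h : ∀ R : HypergradientRun P, ‖gradient P.Phi R.output‖ ≤ ε → m ≤ R.schedule.K + 1)
    (hτ : 0 ≤ τ) (A : HypergradientAlgorithm) :
    ENNReal.ofReal (min (2 * τ) 1 * m) ≤ normComplexity τ A P ε := by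
  refine le_iInf₂ fun R _ => le_iInf fun hR => ENNReal.ofReal_le_ofReal ?_
  calc min (2 * τ) 1 * m ≤ min (2 * τ) 1 * (R.schedule.K + 1) := by
        gcongr
        exact h R hR
    _ ≤ R.cost τ := R.min_mul_le_cost hτ

end HypergradientRun

theorem mainTheorem7_general :
    ∃ (c₀ c₁ : ℝ → ℝ) (c₂ : ℝ → ℝ → ℝ → ℝ → ℝ),
      (∀ τ, 0 < τ → 0 < c₀ τ) ∧
      (∀ τ, 0 < τ → 0 < c₁ τ) ∧
      (∀ τ Ly Ltxy B, 0 < τ → 0 < Ly → 0 < Ltxy → 0 < B → 0 < c₂ τ Ly Ltxy B) ∧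
      ∀ Lx Lxy Ly Ltxy Lty ρxy ρyy μy B ε β : ℝ,
        0 ≤ Lx → 0 ≤ Lxy → 0 ≤ Ly → 0 ≤ Ltxy → 0 ≤ ρxy → 0 ≤ ρyy →
        0 < μy → μy ≤ Lty → 0 < B → 0 < ε → β = (Lty - μy) / 4 →
        (∃! r : ℝ, IsRStar Lx Ly Ltxy μy β B ε r) ∧
        ∀ r : ℝ, IsRStar Lx Ly Ltxy μy β B ε r →
          ∃ (d : ℕ) (P : BilevelProblem d d),
            InCSC Lx Lxy Ly Ltxy Lty ρxy ρyy μy B P ∧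
            (∀ R : HypergradientRun P, ‖gradient P.Phi R.output‖ ≤ ε →
              ⌊r⌋ - 3 ≤ (R.schedule.K : ℤ) + (R.schedule.Q : ℤ) * (R.schedule.T : ℤ)
                - (R.schedule.Q : ℤ) + 3) ∧
            ∀ (τ : ℝ) (A : HypergradientAlgorithm), 0 < τ →
              ENNReal.ofReal (c₀ τ * r) ≤ normComplexity τ A P ε ∧
              ENNReal.ofReal (c₁ τ * (√B * √(Ltxy ^ 2 * Ly + Lx * μy ^ 2) / (μy * √ε)))
                ≤ normComplexity τ A P ε ∧
              ENNReal.ofReal (c₂ τ Ly Ltxy B * (1 / √ε * (1 / μy)))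
                ≤ normComplexity τ A P ε := by
  refine ⟨fun τ => min (2 * τ) 1, fun τ => min (2 * τ) 1 / 2,
    fun τ Ly Ltxy B => min (2 * τ) 1 / 2 * (√B * Ltxy * √Ly), fun τ _ => by positivity,
    fun τ _ => by positivity, fun τ Ly Ltxy B _ _ _ _ => by positivity, ?_⟩
  intro Lx Lxy Ly Ltxy Lty ρxy ρyy μy B ε β hLx hLxy hLy hLtxy hρxy hρyy hμy hμLty hB hε hβ
  have hβ₀ : 0 ≤ β := by linarith
  refine ⟨IsRStar.existsUnique hμy.le hβ₀, fun r hr => ?_⟩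
  obtain ⟨d, P, hP, hrate⟩ := exists_inCSC_forall_rate_le hLx hLxy hLy hLtxy hρxy hρyy hμy hμLty
    hB.le hε
  have hK : ∀ R : HypergradientRun P, ‖gradient P.Phi R.output‖ ≤ ε → r ≤ R.schedule.K + 1 :=
    fun R hR => (hr.le_rate hLx hLy hμy hβ₀ hB.le hε).trans (hrate R hR)
  refine ⟨d, P, hP, fun R hR => HypergradientRun.floor_le_of_le_K_add_one (hK R hR),
    fun τ A hτ => ⟨HypergradientRun.ofReal_min_mul_le_normComplexity hK hτ.le A, ?_⟩⟩
  have hrate_le := HypergradientRun.ofReal_min_mul_le_normComplexity hrate hτ.le A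
  rw [mul_div_assoc', ← div_mul_eq_mul_div] at hrate_le
  refine ⟨hrate_le, (ENNReal.ofReal_le_ofReal ?_).trans hrate_le⟩
  rw [mul_assoc]
  gcongr
  exact mul_le_rate hLx hLtxy hμy.le

theorem mainTheorem7 :
    -- `c₀ τ`, `c₁ τ κ`, `c₂ τ β₀ Lx Ly Ltxy B` are the constants hidden in the three `Ω`'s
    ∃ (c₀ : ℝ → ℝ) (c₁ : ℝ → ℝ → ℝ) (c₂ : ℝ → ℝ → ℝ → ℝ → ℝ → ℝ → ℝ),
      (∀ τ, 0 < τ → 0 < c₀ τ) ∧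
      (∀ τ κ, 0 < τ → 0 < κ → 0 < c₁ τ κ) ∧
      (∀ τ β₀ Lx Ly Ltxy B, 0 < τ → 0 < β₀ → 0 ≤ Lx → 0 < Ly → 0 < Ltxy → 0 < B →
        0 < c₂ τ β₀ Lx Ly Ltxy B) ∧
      ∀ Lx Lxy Ly Ltxy Lty ρxy ρyy μy B ε β : ℝ,
        0 ≤ Lx → 0 ≤ Lxy → 0 ≤ Ly → 0 ≤ Ltxy → 0 ≤ ρxy → 0 ≤ ρyy →
        0 < μy → μy ≤ Lty → 0 < B → 0 < ε → β = (Lty - μy) / 4 →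
        (∃! r : ℝ, IsRStar Lx Ly Ltxy μy β B ε r) ∧
        ∀ r : ℝ, IsRStar Lx Ly Ltxy μy β B ε r →
          ∃ (d : ℕ) (P : BilevelProblem d d),
            InCSC Lx Lxy Ly Ltxy Lty ρxy ρyy μy B P ∧
            (∀ R : HypergradientRun P, ‖gradient P.Phi R.output‖ ≤ ε →
              ⌊r⌋ - 3 ≤ (R.schedule.K : ℤ) + (R.schedule.Q : ℤ) * (R.schedule.T : ℤ)
                - (R.schedule.Q : ℤ) + 3) ∧
            ∀ (τ : ℝ) (A : HypergradientAlgorithm), 0 < τ →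
              ENNReal.ofReal (c₀ τ * r) ≤ normComplexity τ A P ε ∧
              (∀ κ : ℝ, 0 < κ → β ≤ κ * μy →
                ENNReal.ofReal (c₁ τ κ *
                  (Real.sqrt B * Real.sqrt (Ltxy ^ 2 * Ly + Lx * μy ^ 2) /
                    (μy * Real.sqrt ε))) ≤ normComplexity τ A P ε) ∧
              (∀ β₀ : ℝ, 0 < β₀ → β ≤ β₀ → 0 < Ly → 0 < Ltxy →
                ENNReal.ofReal (c₂ τ β₀ Lx Ly Ltxy B *
                  (1 / Real.sqrt ε * min (1 / μy) (1 / Real.sqrt (ε ^ 3))))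
                    ≤ normComplexity τ A P ε) := by
  obtain ⟨c₀, c₁, c₂, h₀, h₁, h₂, h⟩ := mainTheorem7_general
  refine ⟨c₀, fun τ _ => c₁ τ, fun τ _ _ Ly Ltxy B => c₂ τ Ly Ltxy B, h₀, fun τ _ hτ _ => h₁ τ hτ,
    fun τ _ _ Ly Ltxy B hτ _ _ => h₂ τ Ly Ltxy B hτ, ?_⟩
  intro Lx Lxy Ly Ltxy Lty ρxy ρyy μy B ε β hLx hLxy hLy hLtxy hρxy hρyy hμy hμLty hB hε hβ
  refine (h Lx Lxy Ly Ltxy Lty ρxy ρyy μy B ε β hLx hLxy hLy hLtxy hρxy hρyy hμy hμLty hB hε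
    hβ).imp_right fun hr r hrstar => (hr r hrstar).imp fun d ⟨P, hP, hM, hC⟩ =>
      ⟨P, hP, hM, fun τ A hτ => ?_⟩
  obtain ⟨hC₀, hC₁, hC₂⟩ := hC τ A hτ
  refine ⟨hC₀, fun _ _ _ => hC₁, fun _ _ _ hLy hLtxy => (ENNReal.ofReal_le_ofReal ?_).trans hC₂⟩
  have hc₂ := h₂ τ Ly Ltxy B hτ hLy hLtxy hB
  gcongr
  exact min_le_left _ _
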